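/- Let $|\psi\rangle\in\mathbb{C}^2\otimes\mathbb{C}^2\otimes\mathbb{C}^2$ be a unit vector and $\rho_{123}=|\psi\rangle\langle\psi|$ the corresponding pure three-qubit state. For a two-qubit state $\rho_{kl}$ (the sender holding qubit $k$, the receiver qubit $l$) let $C(\rho_{kl})=1+S(\rho_l)-S(\rho_{kl})$ be its dense coding capacity, where $S(\rho)=-\mathrm{Tr}(\rho\log_2\rho)$ and $\rho_l=\mathrm{Tr}_k\,\rho_{kl}$. For a permutation $(j,k,l)$ of $(1,2,3)$ let $$C_{CD}^{jkl}(\rho_{123})=\max_{U}\sum_{i=0}^{1}\langle i|U\rho_jU^\dagger|i\rangle\,C(\rho_{kl}^i),$$ where the maximum is over all $2\times2$ unitary matrices $U$, $\rho_j$ is the reduced state of qubit $j$, and $\rho_{kl}^i$ is the state of qubits $k,l$ after outcome $i$ when qubit $j$ is measured in the orthonormal basis $\{U^\dagger|0\rangle,U^\dagger|1\rangle\}$ (an outcome of probability zero contributes $0$). Let $$P^{jkl}(\rho_{123})=C_{CD}^{jkl}(\rho_{123})-C(\rho_{kl}),\qquad \rho_{kl}=\mathrm{Tr}_j\,\rho_{123},$$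 and let the minimal control power be $P(\rho_{123})=\min_{j,k,l}P^{jkl}(\rho_{123})$, the minimum being over all permutations $(j,k,l)$ of $(1,2,3)$. Then $P(\rho_{123})=0$ if and only if $\rho_{123}$ is biseparable (that is, $|\psi\rangle$ is a tensor product of a vector of one of the three qubits and a vector of the other two) or fully separable (that is, $|\psi\rangle$ is a tensor product of three single-qubit vectors). -/

import Mathlib

noncomputable section

namespace DenseCoding

open Matrix
open scoped Kronecker ComplexOrder

/-- The von Neumann entropy `S(ρ) = -Tr (ρ log₂ ρ)`, in bits. The logarithm of the Hermitian
matrix `ρ` is the functional calculus of `Real.logb 2`; since `Real.logb 2 0 = 0`, the kernel of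
`ρ` contributes `0 · log₂ 0 = 0`. -/
def entropy {n : Type*} [Fintype n] [DecidableEq n] (ρ : Matrix n n ℂ) : ℝ :=
  -(ρ * cfc (Real.logb 2) ρ).trace.re

/-- Partial trace over the first tensor factor. -/
def traceFst {m n : Type*} [Fintype m] (ρ : Matrix (m × n) (m × n) ℂ) : Matrix n n ℂ :=
  Matrix.of fun a b => ∑ i, ρ (i, a) (i, b)

/-- Partial trace over the second tensor factor. -/
def traceSnd {m n : Type*} [Fintype n] (ρ : Matrix (m × n) (m × n) ℂ) : Matrix m m ℂ :=
  Matrix.of fun a b => ∑ i, ρ (a, i) (b, i)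

/-- The dense coding capacity `C(ρ) = 1 + S(ρ_B) - S(ρ)` of a two-qubit state, where Alice (the
sender) has the first and Bob (the receiver) the second qubit. -/
def capacity (ρ : Matrix (Fin 2 × Fin 2) (Fin 2 × Fin 2) ℂ) : ℝ :=
  1 + entropy (traceFst ρ) - entropy ρ

/-- The operator `(U ⊗ 1) ρ (U ⊗ 1)†` on (Charlie) ⊗ (Alice ⊗ Bob). -/
def rotate (U : Matrix (Fin 2) (Fin 2) ℂ)
    (ρ : Matrix (Fin 2 × (Fin 2 × Fin 2)) (Fin 2 × (Fin 2 × Fin 2)) ℂ) :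
    Matrix (Fin 2 × (Fin 2 × Fin 2)) (Fin 2 × (Fin 2 × Fin 2)) ℂ :=
  (U ⊗ₖ (1 : Matrix (Fin 2 × Fin 2) (Fin 2 × Fin 2) ℂ)) * ρ *
    (U ⊗ₖ (1 : Matrix (Fin 2 × Fin 2) (Fin 2 × Fin 2) ℂ))ᴴ

/-- The probability `⟨i| U ρ_C U† |i⟩` of Charlie's outcome `i`, where Charlie has the first of
the three qubits and `ρ_C` is its reduced state. -/
def outcomeProb (U : Matrix (Fin 2) (Fin 2) ℂ)
    (ρ : Matrix (Fin 2 × (Fin 2 × Fin 2)) (Fin 2 × (Fin 2 × Fin 2)) ℂ) (i : Fin 2) : ℝ :=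
  ((U * traceSnd ρ * Uᴴ) i i).re

/-- The state shared by Alice and Bob after Charlie's outcome `i`: the normalization of
`⟨i|_C (U ⊗ 1) ρ (U ⊗ 1)† |i⟩_C`. (If the outcome has probability zero this is the zero matrix;
it then enters the average capacity with weight zero.) -/
def postState (U : Matrix (Fin 2) (Fin 2) ℂ)
    (ρ : Matrix (Fin 2 × (Fin 2 × Fin 2)) (Fin 2 × (Fin 2 × Fin 2)) ℂ) (i : Fin 2) :
    Matrix (Fin 2 × Fin 2) (Fin 2 × Fin 2) ℂ :=
  (outcomeProb U ρ i)⁻¹ • (rotate U ρ).submatrix (Prod.mk i) (Prod.mk i)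

/-- The average dense coding capacity when Charlie measures in the basis given by `U`. -/
def avgCapacity (U : Matrix (Fin 2) (Fin 2) ℂ)
    (ρ : Matrix (Fin 2 × (Fin 2 × Fin 2)) (Fin 2 × (Fin 2 × Fin 2)) ℂ) : ℝ :=
  ∑ i, outcomeProb U ρ i * capacity (postState U ρ i)

/-- The controlled dense coding capacity: the maximum of the average capacity over all `2 × 2`
unitary matrices. The supremum is attained, see `controlledCapacity_isGreatest`. -/
def controlledCapacity
    (ρ : Matrix (Fin 2 × (Fin 2 × Fin 2)) (Fin 2 × (Fin 2 × Fin 2)) ℂ) : ℝ :=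
  ⨆ U : Matrix.unitaryGroup (Fin 2) ℂ, avgCapacity (U : Matrix (Fin 2) (Fin 2) ℂ) ρ

/-- Reorder the qubits of a three-qubit state as (Charlie, Alice, Bob), where Charlie has qubit
`σ 0`, Alice has qubit `σ 1` and Bob has qubit `σ 2`. A basis vector of the three qubits is
labelled by `x : Fin 3 → Fin 2`, `x q` being the label of qubit `q`. -/
def arrange (σ : Equiv.Perm (Fin 3)) (ρ : Matrix (Fin 3 → Fin 2) (Fin 3 → Fin 2) ℂ) :
    Matrix (Fin 2 × (Fin 2 × Fin 2)) (Fin 2 × (Fin 2 × Fin 2)) ℂ :=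
  ρ.submatrix (fun y q => ![y.1, y.2.1, y.2.2] (σ.symm q))
    (fun y q => ![y.1, y.2.1, y.2.2] (σ.symm q))

/-- The control power of Charlie for the distribution `σ` of the qubits: the controlled dense
coding capacity minus the capacity of the reduced state of Alice and Bob. -/
def controlPower (σ : Equiv.Perm (Fin 3)) (ρ : Matrix (Fin 3 → Fin 2) (Fin 3 → Fin 2) ℂ) : ℝ :=
  controlledCapacity (arrange σ ρ) - capacity (traceFst (arrange σ ρ))

/-- The minimal control power: the minimum of the control power over all permutations. -/
def minControlPower (ρ : Matrix (Fin 3 → Fin 2) (Fin 3 → Fin 2) ℂ) : ℝ :=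
  Finset.univ.inf' Finset.univ_nonempty fun σ : Equiv.Perm (Fin 3) => controlPower σ ρ

/-- The density matrix `|ψ⟩⟨ψ|`. -/
def pureState {n : Type*} (ψ : EuclideanSpace ℂ n) : Matrix n n ℂ :=
  Matrix.vecMulVec (fun x => ψ x) (fun x => star (ψ x))

/-- A three-qubit state vector is biseparable if it is a tensor product of a vector of one of the
qubits and a vector of the other two (which may or may not be entangled). -/
def IsBiseparable (ψ : EuclideanSpace ℂ (Fin 3 → Fin 2)) : Prop :=
  ∃ (σ : Equiv.Perm (Fin 3)) (a : Fin 2 → ℂ) (b : Fin 2 × Fin 2 → ℂ),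
    ∀ x : Fin 3 → Fin 2, ψ x = a (x (σ 0)) * b (x (σ 1), x (σ 2))

/-- A three-qubit state vector is fully separable if it is a tensor product of three vectors of
the single qubits. -/
def IsFullySeparable (ψ : EuclideanSpace ℂ (Fin 3 → Fin 2)) : Prop :=
  ∃ a b c : Fin 2 → ℂ, ∀ x : Fin 3 → Fin 2, ψ x = a (x 0) * b (x 1) * c (x 2)

/-! The maximum over Charlie's measurement bases exists. -/

/-- `Tr (ρ log₂ ρ)` as the trace of a functional calculus. -/
def trLog {n : Type*} [Fintype n] [DecidableEq n] (ρ : Matrix n n ℂ) : ℝ :=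
  (cfc (fun x : ℝ => x * Real.logb 2 x) ρ).trace.re

theorem continuousOn_of_finite_spectrum {n : Type*} [Fintype n] [DecidableEq n]
    (f : ℝ → ℝ) (ρ : Matrix n n ℂ) : ContinuousOn f (spectrum ℝ ρ) :=
  Set.Finite.continuousOn (Matrix.finite_real_spectrum (A := ρ)) f

theorem entropy_eq_neg_trLog {n : Type*} [Fintype n] [DecidableEq n] {ρ : Matrix n n ℂ}
    (h : ρ.IsHermitian) : entropy ρ = -trLog ρ := by
  have hs : IsSelfAdjoint ρ := h
  unfold entropy trLog
  rw [cfc_mul (fun x : ℝ => x) (Real.logb 2) ρ (continuousOn_of_finite_spectrum _ _)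
    (continuousOn_of_finite_spectrum _ _), cfc_id' ℝ ρ]

theorem entropy_smul {n : Type*} [Fintype n] [DecidableEq n] {ρ : Matrix n n ℂ}
    (h : ρ.IsHermitian) {c : ℝ} (hc : c ≠ 0) :
    entropy (c • ρ) = -(c * trLog ρ + c * Real.logb 2 c * ρ.trace.re) := by
  have hs : IsSelfAdjoint ρ := h
  have hcs : IsSelfAdjoint (c • ρ) := IsSelfAdjoint.smul (IsSelfAdjoint.all c) hs
  rw [entropy_eq_neg_trLog hcs]
  congr 1
  unfold trLog
  rw [← cfc_comp_smul c (fun x : ℝ => x * Real.logb 2 x) ρ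
    ((Set.Finite.image _ (Matrix.finite_real_spectrum (A := ρ))).continuousOn _)]
  have : (fun x : ℝ => c • x * Real.logb 2 (c • x)) =
      fun x : ℝ => c • (x * Real.logb 2 x) + (c * Real.logb 2 c) • x := by
    funext x
    rcases eq_or_ne x 0 with rfl | hx
    · simp
    · simp only [smul_eq_mul, Real.logb_mul hc hx]; ring
  rw [this, cfc_add ρ _ _ (continuousOn_of_finite_spectrum _ _)
    (continuousOn_of_finite_spectrum _ _), cfc_smul _ _ ρ (continuousOn_of_finite_spectrum _ _),
    cfc_smul _ _ ρ (continuousOn_of_finite_spectrum _ _), cfc_id' ℝ ρ]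
  simp [Matrix.trace_add, Matrix.trace_smul]

open scoped Matrix.Norms.L2Operator in
theorem continuous_trLog {X n : Type*} [TopologicalSpace X] [Fintype n] [DecidableEq n]
    {f : X → Matrix n n ℂ} (hf : Continuous f) (h : ∀ x, (f x).IsHermitian) :
    Continuous fun x => trLog (f x) := by
  have hc : Continuous fun x : ℝ => x * Real.logb 2 x := by
    have : (fun x : ℝ => x * Real.logb 2 x) = fun x => x * Real.log x / Real.log 2 := by
      funext x; simp [Real.logb, mul_div_assoc]
    rw [this]
    exact Real.continuous_mul_log.div_const _
  have h1 : Continuous fun x => cfc (fun x : ℝ => x * Real.logb 2 x) (f x) :=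
    Continuous.cfc_of_mem_nhdsSet (s := Set.univ) (fun x : ℝ => x * Real.logb 2 x)
      Filter.univ_mem hf (fun x => h x) hc.continuousOn
  exact Complex.continuous_re.comp h1.matrix_trace

theorem posSemidef_rotate {ρ : Matrix (Fin 2 × (Fin 2 × Fin 2)) (Fin 2 × (Fin 2 × Fin 2)) ℂ}
    (hρ : ρ.PosSemidef) (U : Matrix (Fin 2) (Fin 2) ℂ) : (rotate U ρ).PosSemidef :=
  hρ.mul_mul_conjTranspose_same _

theorem isHermitian_traceFst {m n : Type*} [Fintype m] {ρ : Matrix (m × n) (m × n) ℂ}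
    (hρ : ρ.IsHermitian) : (traceFst ρ).IsHermitian := by
  ext a b
  simp only [traceFst, Matrix.conjTranspose_apply, Matrix.of_apply, star_sum]
  exact Finset.sum_congr rfl fun i _ => hρ.apply _ _

theorem trace_traceFst {m n : Type*} [Fintype m] [Fintype n] (ρ : Matrix (m × n) (m × n) ℂ) :
    (traceFst ρ).trace = ρ.trace := by
  simp only [Matrix.trace, traceFst, Matrix.diag_apply, Matrix.of_apply, Fintype.sum_prod_type]
  exact Finset.sum_comm

theorem traceFst_smul {m n : Type*} [Fintype m] (c : ℝ) (ρ : Matrix (m × n) (m × n) ℂ) :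
    traceFst (c • ρ) = c • traceFst ρ := by
  ext a b
  simp [traceFst, Finset.mul_sum]

theorem outcomeProb_eq_trace (U : Matrix (Fin 2) (Fin 2) ℂ)
    (ρ : Matrix (Fin 2 × (Fin 2 × Fin 2)) (Fin 2 × (Fin 2 × Fin 2)) ℂ) (i : Fin 2) :
    outcomeProb U ρ i = ((rotate U ρ).submatrix (Prod.mk i) (Prod.mk i)).trace.re := by
  unfold outcomeProb rotate
  congr 1
  simp only [Matrix.trace, Matrix.diag_apply, Matrix.submatrix_apply, Matrix.mul_apply, traceSnd,
    Matrix.of_apply, Matrix.conjTranspose_apply, Matrix.kroneckerMap_apply, Matrix.one_apply,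
    Fintype.sum_prod_type, Fin.sum_univ_two]
  simp
  ring

theorem outcomeProb_mul_capacity
    {ρ : Matrix (Fin 2 × (Fin 2 × Fin 2)) (Fin 2 × (Fin 2 × Fin 2)) ℂ}
    (hρ : ρ.PosSemidef) (U : Matrix (Fin 2) (Fin 2) ℂ) (i : Fin 2) :
    outcomeProb U ρ i * capacity (postState U ρ i) =
      outcomeProb U ρ i + trLog ((rotate U ρ).submatrix (Prod.mk i) (Prod.mk i))
        - trLog (traceFst ((rotate U ρ).submatrix (Prod.mk i) (Prod.mk i))) := by
  have hσ : ((rotate U ρ).submatrix (Prod.mk i) (Prod.mk i)).PosSemidef :=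
    (posSemidef_rotate hρ U).submatrix _
  have hp := outcomeProb_eq_trace U ρ i
  unfold capacity postState
  generalize (rotate U ρ).submatrix (Prod.mk i) (Prod.mk i) = τ at *
  rcases eq_or_ne (outcomeProb U ρ i) 0 with h0 | h0
  · have ht : τ.trace = 0 := by
      apply Complex.ext
      · rw [← hp, h0]; rfl
      · exact (Complex.le_def.1 hσ.trace_nonneg).2.symm
    have hz : τ = 0 := hσ.trace_eq_zero_iff.1 ht
    have hz' : traceFst τ = 0 := by
      rw [hz]; ext a b; simp [traceFst]
    rw [h0, hz', hz]
    simp [trLog]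
  · rw [traceFst_smul, entropy_smul (isHermitian_traceFst hσ.isHermitian) (inv_ne_zero h0),
      entropy_smul hσ.isHermitian (inv_ne_zero h0), trace_traceFst]
    field_simp
    ring

theorem continuous_avgCapacity
    {ρ : Matrix (Fin 2 × (Fin 2 × Fin 2)) (Fin 2 × (Fin 2 × Fin 2)) ℂ} (hρ : ρ.PosSemidef) :
    Continuous fun U : Matrix (Fin 2) (Fin 2) ℂ => avgCapacity U ρ := by
  have hr : Continuous fun U : Matrix (Fin 2) (Fin 2) ℂ => rotate U ρ := by
    have hk : Continuous fun U : Matrix (Fin 2) (Fin 2) ℂ =>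
        U ⊗ₖ (1 : Matrix (Fin 2 × Fin 2) (Fin 2 × Fin 2) ℂ) := by
      refine continuous_matrix fun a b => ?_
      simp only [Matrix.kroneckerMap_apply]
      exact (continuous_id.matrix_elem _ _).mul continuous_const
    exact (hk.matrix_mul continuous_const).matrix_mul hk.matrix_conjTranspose
  have hs : ∀ i : Fin 2, Continuous fun U : Matrix (Fin 2) (Fin 2) ℂ =>
      (rotate U ρ).submatrix (Prod.mk i) (Prod.mk i) := fun i => hr.matrix_submatrix _ _
  have ht : ∀ i : Fin 2, Continuous fun U : Matrix (Fin 2) (Fin 2) ℂ =>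
      traceFst ((rotate U ρ).submatrix (Prod.mk i) (Prod.mk i)) := fun i =>
    continuous_matrix fun a b => by
      simp only [traceFst, Matrix.of_apply]
      exact continuous_finsetSum _ fun c _ => (hs i).matrix_elem (c, a) (c, b)
  have hh : ∀ (i : Fin 2) (U : Matrix (Fin 2) (Fin 2) ℂ),
      ((rotate U ρ).submatrix (Prod.mk i) (Prod.mk i)).IsHermitian := fun i U =>
    ((posSemidef_rotate hρ U).submatrix _).isHermitian
  unfold avgCapacity
  refine continuous_finsetSum _ fun i _ => ?_
  simp only [outcomeProb_mul_capacity hρ]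
  simp only [outcomeProb_eq_trace]
  exact ((Complex.continuous_re.comp (hs i).matrix_trace).add
    (continuous_trLog (hs i) (hh i))).sub
    (continuous_trLog (ht i) fun U => isHermitian_traceFst (hh i U))

open scoped Matrix.Norms.Elementwise in
theorem isCompact_unitaryGroup :
    IsCompact (Matrix.unitaryGroup (Fin 2) ℂ : Set (Matrix (Fin 2) (Fin 2) ℂ)) := by
  refine Metric.isCompact_of_isClosed_isBounded ?_ ?_
  · have : (Matrix.unitaryGroup (Fin 2) ℂ : Set (Matrix (Fin 2) (Fin 2) ℂ)) =
        {U | U * Uᴴ = 1} := by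
      ext U; exact Matrix.mem_unitaryGroup_iff
    rw [this]
    exact isClosed_eq (continuous_id.matrix_mul continuous_id.matrix_conjTranspose)
      continuous_const
  · refine isBounded_iff_forall_norm_le.2 ⟨1, fun U hU => ?_⟩
    exact entrywise_sup_norm_bound_of_unitary hU

/-- The supremum over Charlie's measurement bases is a maximum. -/
theorem controlledCapacity_isGreatest
    {ρ : Matrix (Fin 2 × (Fin 2 × Fin 2)) (Fin 2 × (Fin 2 × Fin 2)) ℂ} (hρ : ρ.PosSemidef) :
    IsGreatest (Set.range fun U : Matrix.unitaryGroup (Fin 2) ℂ =>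
      avgCapacity (U : Matrix (Fin 2) (Fin 2) ℂ) ρ) (controlledCapacity ρ) := by
  have : CompactSpace (Matrix.unitaryGroup (Fin 2) ℂ) :=
    isCompact_iff_compactSpace.1 isCompact_unitaryGroup
  exact (isCompact_range ((continuous_avgCapacity hρ).comp continuous_subtype_val)).isGreatest_sSup
    (Set.range_nonempty _)

end DenseCoding

end

namespace DenseCoding

open Matrix
open scoped Kronecker ComplexOrder

/-! Write Charlie, Alice, Bob for the holders of the qubits j, k, l. If Charlie measures in an
eigenbasis of his reduced state, the two unnormalized post-measurement vectors v, w are orthogonal,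
so the entropy of Alice and Bob's joint state is that of the outcome distribution. Charlie's gain is
then Tr f(A + B) - Tr f(A) - Tr f(B), with f(x) = x log₂ x and A, B the reduced states of Bob in the
two branches. It is nonnegative by `trLog_superadditive`, so every control power is nonnegative, and
the minimum vanishes exactly when one of them does.

Suppose one does. If v or w is zero, Charlie's qubit factors out. Otherwise the equality case
`orthogonal_of_trLog_add_le` makes A and B rank one with orthogonal ranges, so v = a ⊗ b and w = c ⊗
d with b ⊥ d. Then ρ_B and ρ_AB have the same entropy, and the gain in any other basis is the
average entanglement entropy of the branches. It must vanish in the basis rotated by the Hadamard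
matrix, so v + w is a product as well. This forces a ∥ c or b ∥ d. The latter contradicts b ⊥ d, so
Alice's qubit factors out.

Conversely, if Charlie's qubit factors out, every outcome of nonzero probability leaves the same
state, and his control power is zero. -/

/-! ### Convexity of x log₂ x on pairs with a fixed sum -/

/-- The function `x ↦ x log₂ x`. -/
noncomputable def xlog (x : ℝ) : ℝ := x * Real.logb 2 x

theorem xlog_zero : xlog 0 = 0 := by simp [xlog]

theorem strictConvexOn_xlog : StrictConvexOn ℝ (Set.Ici 0) xlog := by
  refine ⟨convex_Ici 0, fun x hx y hy hxy a b ha hb hab => ?_⟩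
  have h := Real.strictConvexOn_mul_log.2 hx hy hxy ha hb hab
  have hl : 0 < Real.log 2 := Real.log_pos (by norm_num)
  simp only [smul_eq_mul] at h ⊢
  have e : ∀ z, xlog z = z * Real.log z / Real.log 2 := fun z => by
    simp [xlog, Real.logb, mul_div_assoc]
  rw [e, e, e, ← mul_div_assoc, ← mul_div_assoc, ← add_div]
  exact div_lt_div_of_pos_right h hl

/-- Two nonnegative pairs with the same sum: the one with the smaller product is more spread out,
so that it has the larger value of a strictly convex function. -/
theorem xlog_add_lt_of_mul_lt {x y u v : ℝ} (hx : 0 ≤ x) (hy : 0 ≤ y)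
    (hs : x + y = u + v) (hp : x * y < u * v) : xlog u + xlog v < xlog x + xlog y := by
  have hne : x ≠ y := by
    rintro rfl
    nlinarith [sq_nonneg (u - v)]
  wlog hxy : x < y generalizing x y
  · rw [add_comm (xlog x)]
    exact this hy hx (by linarith) (by linarith) hne.symm
      (lt_of_le_of_ne (not_lt.1 hxy) hne.symm)
  have hd : 0 < y - x := sub_pos.2 hxy
  -- With v = x + y - u, the product equals uv - xy; hence u lies strictly between x and y. Then u
  -- and v are convex combinations of x and y with exchanged weights, and the two convexity
  -- inequalities add up to the claim.
  have hprod : 0 < (u - x) * (y - u) := by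
    have : v = x + y - u := by linarith
    subst this
    nlinarith
  have hux : 0 < u - x := by
    rcases pos_and_pos_or_neg_and_neg_of_mul_pos hprod with h | h
    · exact h.1
    · linarith [h.1, h.2]
  have hyu : 0 < y - u := pos_of_mul_pos_right hprod hux.le
  have h1 := strictConvexOn_xlog.2 hx hy hne (div_pos hyu hd) (div_pos hux hd)
    (by field_simp; ring)
  have h2 := strictConvexOn_xlog.2 hx hy hne (div_pos hux hd) (div_pos hyu hd)
    (by field_simp; ring)
  simp only [smul_eq_mul] at h1 h2
  have e1 : (y - u) / (y - x) * x + (u - x) / (y - x) * y = u := by field_simp; ring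
  have e2 : (u - x) / (y - x) * x + (y - u) / (y - x) * y = v := by
    have : v = x + y - u := by linarith
    rw [this]; field_simp; ring
  rw [e1] at h1
  rw [e2] at h2
  have e3 : (y - u) / (y - x) + (u - x) / (y - x) = 1 := by field_simp; ring
  have e4 : (y - u) / (y - x) = 1 - (u - x) / (y - x) := by linarith
  rw [e4] at h1 h2
  linarith

/-- Sum and product determine a pair up to order. -/
theorem xlog_add_eq_of_mul_eq {x y u v : ℝ}
    (hs : x + y = u + v) (hp : x * y = u * v) : xlog u + xlog v = xlog x + xlog y := by
  have h : (u - x) * (u - y) = 0 := by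
    have : v = x + y - u := by linarith
    subst this
    linarith
  rcases mul_eq_zero.1 h with h | h
  · obtain rfl : u = x := by linarith
    obtain rfl : v = y := by linarith
    rfl
  · obtain rfl : u = y := by linarith
    obtain rfl : v = x := by linarith
    ring

theorem xlog_add_le_of_mul_le {x y u v : ℝ} (hx : 0 ≤ x) (hy : 0 ≤ y)
    (hs : x + y = u + v) (hp : x * y ≤ u * v) : xlog u + xlog v ≤ xlog x + xlog y := by
  rcases hp.lt_or_eq with h | h
  · exact (xlog_add_lt_of_mul_lt hx hy hs h).le
  · exact (xlog_add_eq_of_mul_eq hs h).le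

/-- The pair (x + y, 0) has the same sum as (x, y) and the smallest possible product. -/
theorem xlog_superadditive {x y : ℝ} (hx : 0 ≤ x) (hy : 0 ≤ y) :
    xlog x + xlog y ≤ xlog (x + y) := by
  have := xlog_add_le_of_mul_le (x := x + y) (y := 0) (u := x) (v := y) (by positivity) le_rfl
    (by ring) (by simpa using mul_nonneg hx hy)
  simpa [xlog_zero] using this

theorem mul_eq_zero_of_xlog_add_eq {x y : ℝ} (hx : 0 ≤ x) (hy : 0 ≤ y)
    (h : xlog (x + y) ≤ xlog x + xlog y) : x * y = 0 := by
  by_contra hne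
  have := xlog_add_lt_of_mul_lt (x := x + y) (y := 0) (u := x) (v := y) (by positivity) le_rfl
    (by ring) (by simpa using lt_of_le_of_ne (mul_nonneg hx hy) (Ne.symm hne))
  rw [xlog_zero] at this
  linarith

/-! ### Tr A log₂ A for positive 2 × 2 matrices -/

theorem trLog_eq_sum_eigenvalues {n : Type*} [Fintype n] [DecidableEq n] {A : Matrix n n ℂ}
    (hA : A.IsHermitian) : trLog A = ∑ i, xlog (hA.eigenvalues i) := by
  have e : trLog A = (cfc xlog A).trace.re := rfl
  rw [e, hA.cfc_eq, Matrix.IsHermitian.cfc, Unitary.conjStarAlgAut_apply, Matrix.trace_mul_cycle]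
  simp [Matrix.trace]

/-- Replaces a positive 2 × 2 matrix by its ordered eigenvalues, so that inequalities for `trLog`
become inequalities for pairs with given sum and product. -/
theorem exists_trLog_eq {A : Matrix (Fin 2) (Fin 2) ℂ} (hA : A.PosSemidef) :
    ∃ x y : ℝ, 0 ≤ y ∧ y ≤ x ∧ x + y = A.trace.re ∧ x * y = A.det.re ∧
      trLog A = xlog x + xlog y := by
  have ht := hA.isHermitian.trace_eq_sum_eigenvalues
  have hd := hA.isHermitian.det_eq_prod_eigenvalues
  have hT := trLog_eq_sum_eigenvalues hA.isHermitian
  have h0 := hA.eigenvalues_nonneg 0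
  have h1 := hA.eigenvalues_nonneg 1
  generalize hA.isHermitian.eigenvalues = e at *
  rw [Fin.sum_univ_two] at ht hT
  rw [Fin.prod_univ_two] at hd
  rw [ht, hd, hT]
  rcases le_total (e 0) (e 1) with h | h
  · exact ⟨e 1, e 0, h0, h, by simp [add_comm], by simp [mul_comm], add_comm _ _⟩
  · exact ⟨e 0, e 1, h1, h, by simp, by simp, rfl⟩

/-- `Tr (A log₂ A)` for a positive `2 × 2` matrix, in terms of trace and determinant. -/
theorem trLog_eq_of_trace_det {A : Matrix (Fin 2) (Fin 2) ℂ} (hA : A.PosSemidef) {u v : ℝ}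
    (ht : u + v = A.trace.re) (hd : u * v = A.det.re) : trLog A = xlog u + xlog v := by
  obtain ⟨x, y, -, -, hs, hp, hT⟩ := exists_trLog_eq hA
  rw [hT]
  exact xlog_add_eq_of_mul_eq (ht.trans hs.symm) (hd.trans hp.symm)

theorem trLog_le_xlog_trace {A : Matrix (Fin 2) (Fin 2) ℂ} (hA : A.PosSemidef) :
    trLog A ≤ xlog A.trace.re := by
  obtain ⟨x, y, hy, hyx, hs, -, hT⟩ := exists_trLog_eq hA
  rw [hT, ← hs]
  exact xlog_superadditive (hy.trans hyx) hy

theorem det_re_eq_zero_of_xlog_trace_le {A : Matrix (Fin 2) (Fin 2) ℂ} (hA : A.PosSemidef)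
    (h : xlog A.trace.re ≤ trLog A) : A.det.re = 0 := by
  obtain ⟨x, y, hy, hyx, hs, hp, hT⟩ := exists_trLog_eq hA
  rw [← hp]
  rw [hT, ← hs] at h
  exact mul_eq_zero_of_xlog_add_eq (hy.trans hyx) hy h

theorem entries_of_isHermitian {A : Matrix (Fin 2) (Fin 2) ℂ} (hA : A.IsHermitian) :
    ∃ (a c r s : ℝ), A = !![(a : ℂ), ⟨r, s⟩; ⟨r, -s⟩, (c : ℂ)] := by
  refine ⟨(A 0 0).re, (A 1 1).re, (A 0 1).re, (A 0 1).im, ?_⟩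
  have h0 := hA.apply 0 0
  have h1 := hA.apply 1 1
  have h2 := hA.apply 1 0
  ext i j
  fin_cases i <;> fin_cases j
  · exact (Complex.conj_eq_iff_re.1 h0).symm
  · rfl
  · exact h2.symm
  · exact (Complex.conj_eq_iff_re.1 h1).symm

/-- The trace inequality of von Neumann for two Hermitian `2 × 2` matrices. -/
theorem le_trace_mul {A B : Matrix (Fin 2) (Fin 2) ℂ} (hA : A.IsHermitian) (hB : B.IsHermitian)
    {x y u v : ℝ} (hyx : y ≤ x) (hvu : v ≤ u) (hAt : x + y = A.trace.re)
    (hAd : x * y = A.det.re) (hBt : u + v = B.trace.re) (hBd : u * v = B.det.re) :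
    x * v + y * u ≤ (A * B).trace.re := by
  obtain ⟨a, c, r, s, rfl⟩ := entries_of_isHermitian hA
  obtain ⟨a', c', r', s', rfl⟩ := entries_of_isHermitian hB
  simp only [Matrix.trace_fin_two, Matrix.det_fin_two, Matrix.mul_apply, Fin.sum_univ_two,
    Matrix.of_apply, Matrix.cons_val', Matrix.cons_val_zero, Matrix.cons_val_one,
    Matrix.cons_val_fin_one, Complex.add_re, Complex.sub_re, Complex.mul_re, Complex.ofReal_re,
    Complex.ofReal_im] at *
  -- The eigenvalue gap is the length of the Bloch vector (a - c, 2r, 2s). Since 2 Tr AB is Tr A Tr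
  -- B plus the inner product of the Bloch vectors, the claim is Cauchy–Schwarz, proved below by
  -- Lagrange's identity.
  have hn : (x - y) ^ 2 = (a - c) ^ 2 + (2 * r) ^ 2 + (2 * s) ^ 2 := by
    have : (x - y) ^ 2 = (x + y) ^ 2 - 4 * (x * y) := by ring
    rw [this, hAt, hAd]; ring
  have hm : (u - v) ^ 2 = (a' - c') ^ 2 + (2 * r') ^ 2 + (2 * s') ^ 2 := by
    have : (u - v) ^ 2 = (u + v) ^ 2 - 4 * (u * v) := by ring
    rw [this, hBt, hBd]; ring
  have hcs : ((a - c) * (a' - c') + (2 * r) * (2 * r') + (2 * s) * (2 * s')) ^ 2 ≤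
      ((x - y) * (u - v)) ^ 2 := by
    rw [mul_pow, hn, hm]
    nlinarith [sq_nonneg ((a - c) * (2 * r') - (2 * r) * (a' - c')),
      sq_nonneg ((a - c) * (2 * s') - (2 * s) * (a' - c')),
      sq_nonneg ((2 * r) * (2 * s') - (2 * s) * (2 * r'))]
  have h := (abs_le_of_sq_le_sq' hcs (mul_nonneg (by linarith) (by linarith))).1
  have ht : (x + y) * (u + v) = (a + c) * (a' + c') := by rw [hAt, hBt]
  nlinarith

theorem det_add_fin_two (A B : Matrix (Fin 2) (Fin 2) ℂ) :
    (A + B).det = A.det + B.det + A.trace * B.trace - (A * B).trace := by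
  simp [Matrix.det_fin_two, Matrix.trace_fin_two, Matrix.mul_apply, Fin.sum_univ_two]
  ring

theorem trace_im_eq_zero {n : Type*} [Fintype n] {A : Matrix n n ℂ} (hA : A.IsHermitian) :
    A.trace.im = 0 := by
  have h : star A.trace = A.trace := by rw [← Matrix.trace_conjTranspose, hA.eq]
  exact Complex.conj_eq_iff_im.1 h

theorem det_add_re {A B : Matrix (Fin 2) (Fin 2) ℂ} (hA : A.IsHermitian) :
    (A + B).det.re = A.det.re + B.det.re + A.trace.re * B.trace.re - (A * B).trace.re := by
  rw [det_add_fin_two]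
  simp [trace_im_eq_zero hA]

/-- By `le_trace_mul`, det (A + B) ≤ (x + v)(y + u) for eigenvalues x ≥ y of A and u ≥ v of B, so
the spectrum of A + B is at least as spread out as the pair x + v, y + u. Scalar superadditivity
then splits each of these two sums. For normalized states this is S(Σ pᵢρᵢ) ≤ H(p) + Σ pᵢS(ρᵢ). -/
theorem trLog_superadditive {A B : Matrix (Fin 2) (Fin 2) ℂ} (hA : A.PosSemidef)
    (hB : B.PosSemidef) : trLog A + trLog B ≤ trLog (A + B) := by
  obtain ⟨x, y, hy, hyx, hs, hp, hT⟩ := exists_trLog_eq hA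
  obtain ⟨u, v, hv, hvu, hs', hp', hT'⟩ := exists_trLog_eq hB
  obtain ⟨z, w, hw, hwz, hs'', hp'', hT''⟩ := exists_trLog_eq (hA.add hB)
  have hle := le_trace_mul hA.isHermitian hB.isHermitian hyx hvu hs hp hs' hp'
  rw [det_add_re hA.isHermitian, ← hp, ← hp', ← hs, ← hs'] at hp''
  rw [Matrix.trace_add, Complex.add_re, ← hs, ← hs'] at hs''
  have h1 := xlog_add_le_of_mul_le (u := x + v) (v := y + u) (hw.trans hwz) hw (by linarith)
    (by linarith)
  have h2 := xlog_superadditive (hy.trans hyx) hv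
  have h3 := xlog_superadditive hy (hv.trans hvu)
  linarith

/-- The equality case of `trLog_superadditive`: the matrices are multiples of orthogonal
projections of rank one. -/
theorem orthogonal_of_trLog_add_le {A B : Matrix (Fin 2) (Fin 2) ℂ} (hA : A.PosSemidef)
    (hB : B.PosSemidef) (hA0 : 0 < A.trace.re) (hB0 : 0 < B.trace.re)
    (h : trLog (A + B) ≤ trLog A + trLog B) :
    A.det.re = 0 ∧ B.det.re = 0 ∧ (A * B).trace.re = 0 := by
  obtain ⟨x, y, hy, hyx, hs, hp, hT⟩ := exists_trLog_eq hA
  obtain ⟨u, v, hv, hvu, hs', hp', hT'⟩ := exists_trLog_eq hB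
  obtain ⟨z, w, hw, hwz, hs'', hp'', hT''⟩ := exists_trLog_eq (hA.add hB)
  have hle := le_trace_mul hA.isHermitian hB.isHermitian hyx hvu hs hp hs' hp'
  rw [det_add_re hA.isHermitian, ← hp, ← hp', ← hs, ← hs'] at hp''
  rw [Matrix.trace_add, Complex.add_re, ← hs, ← hs'] at hs''
  have h1 := xlog_add_le_of_mul_le (u := x + v) (v := y + u) (hw.trans hwz) hw (by linarith)
    (by linarith)
  have h2 := xlog_superadditive (hy.trans hyx) hv
  have h3 := xlog_superadditive hy (hv.trans hvu)
  -- Equality overall forces equality in each link: xv = 0 and yu = 0, where the larger eigenvalues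
  -- x and u are positive because the traces are. A nonzero Tr AB would then make the first link
  -- strict.
  have h4 := mul_eq_zero_of_xlog_add_eq (hy.trans hyx) hv (by linarith)
  have h5 := mul_eq_zero_of_xlog_add_eq hy (hv.trans hvu) (by linarith)
  have hv0 : v = 0 := (mul_eq_zero.1 h4).resolve_left (by intro h; linarith)
  have hy0 : y = 0 := (mul_eq_zero.1 h5).resolve_right (by intro h; linarith)
  refine ⟨by rw [← hp, hy0, mul_zero], by rw [← hp', hv0, mul_zero], ?_⟩
  by_contra hne
  have hlt : 0 < (A * B).trace.re := lt_of_le_of_ne (by linarith) (Ne.symm hne)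
  have := xlog_add_lt_of_mul_lt (u := x + v) (v := y + u) (hw.trans hwz) hw (by linarith)
    (by linarith)
  linarith

/-! ### Tr A log₂ A for Gram matrices and rank-one operators -/

theorem trLog_eq_trace_mul_aeval {n : Type*} [Fintype n] [DecidableEq n] {A : Matrix n n ℂ}
    (hA : A.IsHermitian) {q : Polynomial ℝ}
    (hq : ∀ x ∈ spectrum ℝ A, q.eval x = Real.logb 2 x) :
    trLog A = (A * Polynomial.aeval A q).trace.re := by
  have hs : IsSelfAdjoint A := hA
  unfold trLog
  rw [cfc_mul (fun x : ℝ => x) (Real.logb 2) A (continuousOn_of_finite_spectrum _ _)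
    (continuousOn_of_finite_spectrum _ _), cfc_id' ℝ A, ← cfc_polynomial q A]
  congr 3
  exact cfc_congr fun x hx => (hq x hx).symm

/-- `M Mᴴ` and `Mᴴ M` have the same nonzero eigenvalues. -/
theorem trLog_mul_conjTranspose {m n : Type*} [Fintype m] [DecidableEq m] [Fintype n]
    [DecidableEq n] (M : Matrix m n ℂ) : trLog (M * Mᴴ) = trLog (Mᴴ * M) := by
  classical
  set A := M * Mᴴ with hAdef
  set B := Mᴴ * M with hBdef
  have hA : A.IsHermitian := Matrix.isHermitian_mul_conjTranspose_self M
  have hB : B.IsHermitian := Matrix.isHermitian_conjTranspose_mul_self M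
  have fA := Matrix.finite_real_spectrum (A := A)
  have fB := Matrix.finite_real_spectrum (A := B)
  let s := fA.toFinset ∪ fB.toFinset
  -- One polynomial agrees with log₂ on both finite spectra. For polynomials p the relation p(MMᴴ) M
  -- = M p(MᴴM) is algebraic, and cyclicity of the trace finishes the proof.
  let q : Polynomial ℝ := Lagrange.interpolate s id (Real.logb 2)
  have hq : ∀ x ∈ s, q.eval x = Real.logb 2 x := fun x hx =>
    Lagrange.eval_interpolate_at_node _ (Function.injective_id.injOn) hx
  have hint : ∀ p : Polynomial ℝ, Polynomial.aeval A p * M = M * Polynomial.aeval B p := by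
    intro p
    induction p using Polynomial.induction_on' with
    | add p q hp hq => simp only [map_add, Matrix.add_mul, Matrix.mul_add, hp, hq]
    | monomial k a =>
      simp only [Polynomial.aeval_monomial, ← Algebra.smul_def, Matrix.smul_mul, Matrix.mul_smul]
      congr 1
      induction k with
      | zero => simp
      | succ k ih =>
        rw [pow_succ', pow_succ', Matrix.mul_assoc, ih, hAdef, Matrix.mul_assoc, hBdef,
          ← Matrix.mul_assoc Mᴴ, ← Matrix.mul_assoc M]
  rw [trLog_eq_trace_mul_aeval hA (q := q) fun x hx => hq x (by simp [s, hx]),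
    trLog_eq_trace_mul_aeval hB (q := q) fun x hx => hq x (by simp [s, hx])]
  rw [hAdef, Matrix.mul_assoc, Matrix.trace_mul_comm, Matrix.mul_assoc, ← hAdef, hint q,
    ← Matrix.mul_assoc]

/-- The operator `|v⟩⟨v|`. -/
def proj {n : Type*} (v : n → ℂ) : Matrix n n ℂ := vecMulVec v (star v)

theorem proj_apply {n : Type*} (v : n → ℂ) (x y : n) : proj v x y = v x * star (v y) := rfl

theorem posSemidef_proj {n : Type*} [Finite n] (v : n → ℂ) : (proj v).PosSemidef :=
  posSemidef_vecMulVec_self_star v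

theorem trace_proj_re {n : Type*} [Fintype n] (v : n → ℂ) :
    (proj v).trace.re = ∑ x, ‖v x‖ ^ 2 := by
  rw [Matrix.trace, Complex.re_sum]
  refine Finset.sum_congr rfl fun x _ => ?_
  rw [Matrix.diag_apply, proj_apply, Complex.star_def, Complex.mul_conj, Complex.ofReal_re,
    Complex.normSq_eq_norm_sq]

theorem trace_proj_re_nonneg {n : Type*} [Fintype n] (v : n → ℂ) : 0 ≤ (proj v).trace.re := by
  rw [trace_proj_re]; positivity

theorem eq_zero_of_trace_proj {n : Type*} [Fintype n] {v : n → ℂ} (h : (proj v).trace.re = 0) :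
    v = 0 := by
  rw [trace_proj_re, Finset.sum_eq_zero_iff_of_nonneg fun x _ => by positivity] at h
  funext x
  simpa using h x (Finset.mem_univ x)

theorem trLog_proj {n : Type*} [Fintype n] [DecidableEq n] (v : n → ℂ) :
    trLog (proj v) = xlog (proj v).trace.re := by
  have e : proj v = replicateCol Unit v * (replicateCol Unit v)ᴴ := by
    ext x y
    simp [proj_apply, Matrix.mul_apply]
  have hH := Matrix.isHermitian_conjTranspose_mul_self (replicateCol Unit v)
  rw [e, trLog_mul_conjTranspose, Matrix.trace_mul_comm, trLog_eq_sum_eigenvalues hH,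
    hH.trace_eq_sum_eigenvalues]
  simp

/-- With v, w as the columns of M, the sum is MMᴴ, while MᴴM is the 2 × 2 Gram matrix, diagonal by
orthogonality. -/
theorem trLog_proj_add_proj {n : Type*} [Fintype n] [DecidableEq n] {v w : n → ℂ}
    (h : star v ⬝ᵥ w = 0) :
    trLog (proj v + proj w) = xlog (proj v).trace.re + xlog (proj w).trace.re := by
  let M : Matrix n (Fin 2) ℂ := Matrix.of fun x i => ![v, w] i x
  have e : proj v + proj w = M * Mᴴ := by
    ext x y
    simp [M, proj_apply, Matrix.mul_apply, Fin.sum_univ_two]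
  have e00 : (Mᴴ * M) 0 0 = (proj v).trace := by
    simp [M, Matrix.mul_apply, Matrix.trace, proj_apply, mul_comm]
  have e11 : (Mᴴ * M) 1 1 = (proj w).trace := by
    simp [M, Matrix.mul_apply, Matrix.trace, proj_apply, mul_comm]
  have e01 : (Mᴴ * M) 0 1 = 0 := by
    simpa [M, Matrix.mul_apply, dotProduct] using h
  rw [e, trLog_mul_conjTranspose]
  refine trLog_eq_of_trace_det (Matrix.posSemidef_conjTranspose_mul_self M) ?_ ?_
  · rw [Matrix.trace_fin_two, e00, e11, Complex.add_re]
  · rw [Matrix.det_fin_two, e00, e11, e01, zero_mul, sub_zero, Complex.mul_re,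
      trace_im_eq_zero (posSemidef_proj v).isHermitian, zero_mul, sub_zero]

/-! ### Charlie's measurement and his gain -/

/-- The unnormalized state of Alice and Bob after Charlie's outcome `i`. -/
def branch (U : Matrix (Fin 2) (Fin 2) ℂ) (χ : Fin 2 × (Fin 2 × Fin 2) → ℂ) (i : Fin 2) :
    Fin 2 × Fin 2 → ℂ :=
  fun x => ∑ j, U i j * χ (j, x)

theorem branch_mul (W U : Matrix (Fin 2) (Fin 2) ℂ) (χ : Fin 2 × (Fin 2 × Fin 2) → ℂ)
    (i : Fin 2) : branch (W * U) χ i = fun x => ∑ j, W i j * branch U χ j x := by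
  funext x
  simp only [branch, Matrix.mul_apply, Fin.sum_univ_two]
  ring

theorem eq_sum_branch {U : Matrix (Fin 2) (Fin 2) ℂ} (hU : U ∈ unitaryGroup (Fin 2) ℂ)
    (χ : Fin 2 × (Fin 2 × Fin 2) → ℂ) (j : Fin 2) (x : Fin 2 × Fin 2) :
    χ (j, x) = ∑ i, star (U i j) * branch U χ i x := by
  have h := congrFun (branch_mul (star U) U χ j) x
  rw [Matrix.mem_unitaryGroup_iff'.1 hU] at h
  simpa [branch, Matrix.one_apply, Matrix.star_apply] using h

theorem submatrix_rotate_proj (U : Matrix (Fin 2) (Fin 2) ℂ)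
    (χ : Fin 2 × (Fin 2 × Fin 2) → ℂ) (i : Fin 2) :
    (rotate U (proj χ)).submatrix (Prod.mk i) (Prod.mk i) = proj (branch U χ i) := by
  have e : (U ⊗ₖ (1 : Matrix (Fin 2 × Fin 2) (Fin 2 × Fin 2) ℂ)) *ᵥ χ =
      fun y => branch U χ y.1 y.2 := by
    funext y
    simp only [Matrix.mulVec, dotProduct, branch, Matrix.one_apply, Matrix.kroneckerMap_apply,
      mul_ite, mul_one, mul_zero, ite_mul, zero_mul]
    rw [Fintype.sum_prod_type]
    simp only [Finset.sum_ite_eq, Finset.mem_univ, if_true]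
  have : rotate U (proj χ) = proj fun y => branch U χ y.1 y.2 := by
    rw [rotate, proj, Matrix.mul_vecMulVec, Matrix.vecMulVec_mul, ← Matrix.star_mulVec, e]
    rfl
  rw [this]
  rfl

theorem traceFst_add {m n : Type*} [Fintype m] (ρ τ : Matrix (m × n) (m × n) ℂ) :
    traceFst (ρ + τ) = traceFst ρ + traceFst τ := by
  ext a b
  simp [traceFst, Finset.sum_add_distrib]

theorem posSemidef_traceFst_proj {m n : Type*} [Fintype m] [Finite n] (v : m × n → ℂ) :
    (traceFst (proj v)).PosSemidef := by
  have : traceFst (proj v) = ∑ i, proj fun a => v (i, a) := by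
    ext a b
    simp [traceFst, proj_apply, Matrix.sum_apply]
  rw [this]
  exact Matrix.posSemidef_sum _ fun i _ => posSemidef_proj _

/-- Tracing out Charlie amounts to measuring in any basis and forgetting the outcome. -/
theorem traceFst_proj_eq_add {U : Matrix (Fin 2) (Fin 2) ℂ} (hU : U ∈ unitaryGroup (Fin 2) ℂ)
    (χ : Fin 2 × (Fin 2 × Fin 2) → ℂ) :
    traceFst (proj χ) = proj (branch U χ 0) + proj (branch U χ 1) := by
  have h := Matrix.mem_unitaryGroup_iff.1 hU
  have h00 := congrFun (congrFun h 0) 0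
  have h01 := congrFun (congrFun h 0) 1
  have h10 := congrFun (congrFun h 1) 0
  have h11 := congrFun (congrFun h 1) 1
  simp only [Matrix.mul_apply, Matrix.star_apply, Fin.sum_univ_two, Matrix.one_apply] at *
  norm_num at h00 h01 h10 h11
  ext x y
  simp only [traceFst, Matrix.of_apply, proj_apply, Fin.sum_univ_two, Matrix.add_apply,
    eq_sum_branch hU χ, star_add, star_mul, Complex.star_def, Complex.conj_conj]
  generalize branch U χ 0 x = p
  generalize branch U χ 1 x = q
  generalize (starRingEnd ℂ) (branch U χ 0 y) = p'
  generalize (starRingEnd ℂ) (branch U χ 1 y) = q'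
  linear_combination p * p' * h00 + q * q' * h11 + q * p' * h01 + p * q' * h10

/-- Charlie's average gain when he measures in the basis given by `U`. -/
theorem avgCapacity_sub_capacity {U : Matrix (Fin 2) (Fin 2) ℂ}
    (hU : U ∈ unitaryGroup (Fin 2) ℂ) {χ : Fin 2 × (Fin 2 × Fin 2) → ℂ}
    (hχ : (proj χ).trace.re = 1) :
    avgCapacity U (proj χ) - capacity (traceFst (proj χ)) =
      xlog (proj (branch U χ 0)).trace.re + xlog (proj (branch U χ 1)).trace.re
        - trLog (traceFst (proj (branch U χ 0))) - trLog (traceFst (proj (branch U χ 1)))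
        + trLog (traceFst (proj (branch U χ 0)) + traceFst (proj (branch U χ 1)))
        - trLog (traceFst (proj χ)) := by
  have hH : (traceFst (proj χ)).IsHermitian := isHermitian_traceFst (posSemidef_proj χ).isHermitian
  have ht := congrArg (fun M => M.trace.re) (traceFst_proj_eq_add hU χ)
  simp only [trace_traceFst, hχ, Matrix.trace_add, Complex.add_re] at ht
  rw [avgCapacity, Fin.sum_univ_two, outcomeProb_mul_capacity (posSemidef_proj χ),
    outcomeProb_mul_capacity (posSemidef_proj χ), outcomeProb_eq_trace, outcomeProb_eq_trace,
    submatrix_rotate_proj, submatrix_rotate_proj, trLog_proj, trLog_proj, capacity,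
    entropy_eq_neg_trLog hH, entropy_eq_neg_trLog (isHermitian_traceFst hH),
    ← traceFst_add, ← traceFst_proj_eq_add hU]
  linarith

theorem avgCapacity_le_controlledCapacity {U : Matrix (Fin 2) (Fin 2) ℂ}
    (hU : U ∈ unitaryGroup (Fin 2) ℂ) (χ : Fin 2 × (Fin 2 × Fin 2) → ℂ) :
    avgCapacity U (proj χ) ≤ controlledCapacity (proj χ) :=
  (controlledCapacity_isGreatest (posSemidef_proj χ)).2 ⟨⟨U, hU⟩, rfl⟩

/-- In the eigenbasis of Charlie's qubit the two post-measurement vectors are orthogonal. -/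
theorem exists_orthogonal_branches (χ : Fin 2 × (Fin 2 × Fin 2) → ℂ) :
    ∃ V ∈ unitaryGroup (Fin 2) ℂ, star (branch V χ 0) ⬝ᵥ branch V χ 1 = 0 := by
  have hG : (traceSnd (proj χ)).IsHermitian := by
    ext a b
    simp [traceSnd, proj_apply, mul_comm]
  refine ⟨_, (star hG.eigenvectorUnitary).2, ?_⟩
  have h := hG.conjStarAlgAut_star_eigenvectorUnitary
  rw [Unitary.conjStarAlgAut_apply] at h
  generalize (star hG.eigenvectorUnitary) = V at h ⊢
  -- The off-diagonal entry of Charlie's diagonalized reduced state is the overlap of the two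
  -- branches.
  have h10 := congrFun (congrFun h 1) 0
  rw [Matrix.diagonal_apply_ne _ (by decide)] at h10
  rw [← h10]
  simp only [dotProduct, branch, Matrix.mul_apply, Matrix.star_apply, traceSnd, Matrix.of_apply,
    proj_apply, Fin.sum_univ_two, Fintype.sum_prod_type, Pi.star_apply, star_add, star_mul]
  ring

theorem avgCapacity_sub_capacity_of_orthogonal {χ : Fin 2 × (Fin 2 × Fin 2) → ℂ} (hχ : (proj χ).trace.re = 1)
    {V : Matrix (Fin 2) (Fin 2) ℂ} (hV : V ∈ unitaryGroup (Fin 2) ℂ)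
    (h : star (branch V χ 0) ⬝ᵥ branch V χ 1 = 0) :
    avgCapacity V (proj χ) - capacity (traceFst (proj χ)) =
      trLog (traceFst (proj (branch V χ 0)) + traceFst (proj (branch V χ 1)))
        - trLog (traceFst (proj (branch V χ 0))) - trLog (traceFst (proj (branch V χ 1))) := by
  rw [avgCapacity_sub_capacity hV hχ, traceFst_proj_eq_add hV χ,
    trLog_proj_add_proj h]
  ring

theorem capacity_le_controlledCapacity {χ : Fin 2 × (Fin 2 × Fin 2) → ℂ}
    (hχ : (proj χ).trace.re = 1) :
    capacity (traceFst (proj χ)) ≤ controlledCapacity (proj χ) := by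
  obtain ⟨V, hV, h⟩ := exists_orthogonal_branches χ
  have h1 := avgCapacity_sub_capacity_of_orthogonal hχ hV h
  have h2 := trLog_superadditive (posSemidef_traceFst_proj (branch V χ 0))
    (posSemidef_traceFst_proj (branch V χ 1))
  have h3 := avgCapacity_le_controlledCapacity hV χ
  linarith

/-- Every branch is a multiple of b, so each outcome of nonzero probability leaves the normalized
state of b, which is also the unconditional state. -/
theorem controlledCapacity_le_of_product {χ : Fin 2 × (Fin 2 × Fin 2) → ℂ}
    (hχ : (proj χ).trace.re = 1) {a : Fin 2 → ℂ} {b : Fin 2 × Fin 2 → ℂ}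
    (h : ∀ y, χ y = a y.1 * b y.2) :
    controlledCapacity (proj χ) ≤ capacity (traceFst (proj χ)) := by
  obtain ⟨⟨U, hU⟩, hUeq⟩ := (controlledCapacity_isGreatest (posSemidef_proj χ)).1
  rw [← hUeq]
  have hb : ∀ i, branch U χ i = (U *ᵥ a) i • b := by
    intro i
    funext x
    simp [branch, h, Matrix.mulVec, dotProduct, Fin.sum_univ_two]
    ring
  have hp : ∀ i, proj (branch U χ i) = (‖(U *ᵥ a) i‖ ^ 2 : ℝ) • proj b := by
    intro i
    ext x y
    simp only [hb, proj_apply, Pi.smul_apply, smul_eq_mul, star_mul, Matrix.smul_apply,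
      Complex.real_smul, ← Complex.normSq_eq_norm_sq, ← Complex.mul_conj, Complex.star_def]
    ring
  have hw : traceFst (proj χ) = (‖(U *ᵥ a) 0‖ ^ 2 + ‖(U *ᵥ a) 1‖ ^ 2) • proj b := by
    rw [traceFst_proj_eq_add hU, hp, hp, add_smul]
  have h1 : (‖(U *ᵥ a) 0‖ ^ 2 + ‖(U *ᵥ a) 1‖ ^ 2) * (proj b).trace.re = 1 := by
    rw [← hχ, ← trace_traceFst (proj χ), hw, Matrix.trace_smul, Complex.smul_re, smul_eq_mul]
  have hprob : ∀ i, outcomeProb U (proj χ) i = ‖(U *ᵥ a) i‖ ^ 2 * (proj b).trace.re := by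
    intro i
    rw [outcomeProb_eq_trace, submatrix_rotate_proj, hp, Matrix.trace_smul, Complex.smul_re,
      smul_eq_mul]
  have hc : ∀ i, outcomeProb U (proj χ) i * capacity (postState U (proj χ) i) =
      outcomeProb U (proj χ) i * capacity (traceFst (proj χ)) := by
    intro i
    rcases eq_or_ne (outcomeProb U (proj χ) i) 0 with h0 | h0
    · rw [h0, zero_mul, zero_mul]
    · congr 2
      rw [postState, submatrix_rotate_proj, hp, hw, smul_smul]
      congr 1
      rw [hprob] at h0 ⊢
      have := left_ne_zero_of_mul h0
      have := right_ne_zero_of_mul h0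
      rw [mul_inv, mul_comm, ← mul_assoc, mul_inv_cancel₀ ‹_›, one_mul]
      exact (eq_inv_of_mul_eq_one_left h1).symm
  simp only [avgCapacity, hc, Fin.sum_univ_two]
  rw [← add_mul, hprob, hprob, ← add_mul, h1, one_mul]

/-! ### Product vectors of two qubits -/

/-- The determinant of Bob's reduced state is the squared modulus of the determinant of the
coefficient matrix. -/
theorem coeff_det_eq_zero {v : Fin 2 × Fin 2 → ℂ} (h : (traceFst (proj v)).det.re = 0) :
    v (0, 0) * v (1, 1) = v (0, 1) * v (1, 0) := by
  have e : (traceFst (proj v)).det = Complex.normSq (v (0, 0) * v (1, 1) - v (0, 1) * v (1, 0)) := by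
    rw [← Complex.mul_conj]
    simp only [Matrix.det_fin_two, traceFst, Matrix.of_apply, proj_apply, Fin.sum_univ_two,
      Complex.star_def, map_sub, map_mul]
    ring
  rw [e, Complex.ofReal_re, Complex.normSq_eq_zero] at h
  exact sub_eq_zero.1 h

theorem exists_product_of_det_eq_zero {v : Fin 2 × Fin 2 → ℂ}
    (h : v (0, 0) * v (1, 1) = v (0, 1) * v (1, 0)) :
    ∃ a b : Fin 2 → ℂ, ∀ x, v x = a x.1 * b x.2 := by
  by_cases h00 : v (0, 0) = 0
  · rw [h00, zero_mul, eq_comm, mul_eq_zero] at h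
    rcases h with h | h
    · refine ⟨![0, 1], fun k => v (1, k), ?_⟩
      rintro ⟨i, k⟩
      fin_cases i <;> fin_cases k <;> simp [h00, h]
    · refine ⟨fun i => v (i, 1), ![0, 1], ?_⟩
      rintro ⟨i, k⟩
      fin_cases i <;> fin_cases k <;> simp [h00, h]
  · refine ⟨fun i => v (i, 0) / v (0, 0), fun k => v (0, k), ?_⟩
    rintro ⟨i, k⟩
    fin_cases i <;> fin_cases k <;> simp <;> field_simp
    linear_combination h

/-- Turns Tr AB = 0 for Bob's states into orthogonality of his factors b and d. -/
theorem trace_mul_traceFst_proj {v w : Fin 2 × Fin 2 → ℂ} {a b c d : Fin 2 → ℂ}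
    (hv : ∀ x, v x = a x.1 * b x.2) (hw : ∀ x, w x = c x.1 * d x.2) :
    (traceFst (proj v) * traceFst (proj w)).trace =
      ((∑ i, Complex.normSq (a i)) * (∑ i, Complex.normSq (c i)) *
        Complex.normSq (star b ⬝ᵥ d) : ℝ) := by
  push_cast
  simp only [← Complex.mul_conj, Matrix.trace_fin_two, Matrix.mul_apply, traceFst,
    Matrix.of_apply, proj_apply, hv, hw, Fin.sum_univ_two, Complex.star_def, map_mul, map_add,
    dotProduct, Pi.star_apply, Complex.conj_conj]
  ring

theorem eq_zero_of_sum_normSq {a : Fin 2 → ℂ} (h : ∑ i, Complex.normSq (a i) = 0) : a = 0 := by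
  rw [Finset.sum_eq_zero_iff_of_nonneg fun i _ => Complex.normSq_nonneg _] at h
  funext i
  exact Complex.normSq_eq_zero.1 (h i (Finset.mem_univ i))

/-- Two vectors of `ℂ²` that are both orthogonal and parallel. -/
theorem eq_zero_of_orthogonal_of_parallel {b d : Fin 2 → ℂ} (hb : b ≠ 0)
    (ho : star b ⬝ᵥ d = 0) (hp : b 0 * d 1 = b 1 * d 0) : d = 0 := by
  have hn : (∑ i, (Complex.normSq (b i) : ℂ)) ≠ 0 := by
    intro h
    exact hb (eq_zero_of_sum_normSq (by exact_mod_cast h))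
  simp only [dotProduct, Fin.sum_univ_two, Pi.star_apply, Complex.star_def, ← Complex.mul_conj]
    at ho hn
  funext i
  fin_cases i
  · refine (mul_eq_zero.1 ?_).resolve_left hn
    simp only [Fin.zero_eta]
    linear_combination b 0 * ho - (starRingEnd ℂ) (b 1) * hp
  · refine (mul_eq_zero.1 ?_).resolve_left hn
    simp only [Fin.mk_one]
    linear_combination b 1 * ho + (starRingEnd ℂ) (b 0) * hp

theorem exists_smul_of_parallel {a c : Fin 2 → ℂ} (ha : a ≠ 0) (hp : a 0 * c 1 = a 1 * c 0) :
    ∃ t : ℂ, ∀ i, c i = t * a i := by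
  by_cases h0 : a 0 = 0
  · have h1 : a 1 ≠ 0 := by
      intro h1
      exact ha (by funext i; fin_cases i <;> assumption)
    have hc : c 0 = 0 := by simpa [h0, h1] using hp
    refine ⟨c 1 / a 1, fun i => ?_⟩
    fin_cases i <;> simp [h0, hc]
    field_simp
  · refine ⟨c 0 / a 0, fun i => ?_⟩
    fin_cases i <;> simp <;> field_simp
    linear_combination hp

/-- If two product vectors have orthogonal second factors and a superposition of them is again a
product, then they have the same first factor. -/
theorem exists_common_factor {v w : Fin 2 × Fin 2 → ℂ} (hv0 : v ≠ 0) (hw0 : w ≠ 0)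
    (hv : v (0, 0) * v (1, 1) = v (0, 1) * v (1, 0))
    (hw : w (0, 0) * w (1, 1) = w (0, 1) * w (1, 0))
    (hvw : (v + w) (0, 0) * (v + w) (1, 1) = (v + w) (0, 1) * (v + w) (1, 0))
    (ho : (traceFst (proj v) * traceFst (proj w)).trace.re = 0) :
    ∃ a b d : Fin 2 → ℂ, (∀ x, v x = a x.1 * b x.2) ∧ ∀ x, w x = a x.1 * d x.2 := by
  obtain ⟨a, b, hab⟩ := exists_product_of_det_eq_zero hv
  obtain ⟨c, d, hcd⟩ := exists_product_of_det_eq_zero hw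
  have ha : a ≠ 0 := by rintro rfl; exact hv0 (by funext x; simp [hab])
  have hb : b ≠ 0 := by rintro rfl; exact hv0 (by funext x; simp [hab])
  have hc : c ≠ 0 := by rintro rfl; exact hw0 (by funext x; simp [hcd])
  have hd : d ≠ 0 := by rintro rfl; exact hw0 (by funext x; simp [hcd])
  rw [trace_mul_traceFst_proj hab hcd, Complex.ofReal_re, mul_eq_zero, mul_eq_zero] at ho
  have hbd : star b ⬝ᵥ d = 0 := by
    rcases ho with (h | h) | h
    · exact absurd (eq_zero_of_sum_normSq h) ha
    · exact absurd (eq_zero_of_sum_normSq h) hc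
    · exact Complex.normSq_eq_zero.1 h
  -- The coefficient matrix of a ⊗ b + c ⊗ d is the matrix with columns a, c times the transpose of
  -- the one with columns b, d, so its determinant factors.
  have hprod : (a 0 * c 1 - a 1 * c 0) * (b 0 * d 1 - b 1 * d 0) = 0 := by
    simp only [Pi.add_apply, hab, hcd] at hvw
    linear_combination hvw
  rcases mul_eq_zero.1 hprod with h | h
  · obtain ⟨t, ht⟩ := exists_smul_of_parallel ha (sub_eq_zero.1 h)
    exact ⟨a, b, fun k => t * d k, hab, fun x => by rw [hcd, ht]; ring⟩
  · exact absurd (eq_zero_of_orthogonal_of_parallel hb hbd (sub_eq_zero.1 h)) hd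

/-! ### Vanishing control power forces a factor -/

/-- The Hadamard matrix. -/
noncomputable def hadamard : Matrix (Fin 2) (Fin 2) ℂ :=
  ((Real.sqrt 2)⁻¹ : ℝ) • !![1, 1; 1, -1]

theorem hadamard_mem_unitaryGroup : hadamard ∈ unitaryGroup (Fin 2) ℂ := by
  rw [Matrix.mem_unitaryGroup_iff]
  have h : ((Real.sqrt 2)⁻¹ : ℝ) * ((Real.sqrt 2)⁻¹ : ℝ) = 1 / 2 := by
    rw [← mul_inv, Real.mul_self_sqrt (by norm_num), one_div]
  rw [hadamard, star_smul, Matrix.smul_mul, Matrix.mul_smul, smul_smul, star_trivial, h]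
  ext i j
  fin_cases i <;> fin_cases j <;>
    simp only [Matrix.smul_apply, Matrix.mul_apply, Fin.sum_univ_two, Matrix.star_apply] <;>
    norm_num

/-- If Charlie's control power vanishes, then his qubit or Alice's qubit is unentangled with the
rest. -/
theorem product_of_controlledCapacity_le {χ : Fin 2 × (Fin 2 × Fin 2) → ℂ}
    (hχ : (proj χ).trace.re = 1)
    (h : controlledCapacity (proj χ) ≤ capacity (traceFst (proj χ))) :
    (∃ (a : Fin 2 → ℂ) (b : Fin 2 × Fin 2 → ℂ), ∀ j x, χ (j, x) = a j * b x) ∨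
      ∃ (a : Fin 2 → ℂ) (b : Fin 2 × Fin 2 → ℂ), ∀ j x, χ (j, x) = a x.1 * b (j, x.2) := by
  obtain ⟨V, hV, horth⟩ := exists_orthogonal_branches χ
  have hexp := eq_sum_branch hV χ
  simp only [Fin.sum_univ_two] at hexp
  by_cases hv0 : branch V χ 0 = 0
  · exact Or.inl ⟨fun j => star (V 1 j), branch V χ 1, fun j x => by
      rw [hexp, hv0, Pi.zero_apply, mul_zero, zero_add]⟩
  by_cases hw0 : branch V χ 1 = 0
  · exact Or.inl ⟨fun j => star (V 0 j), branch V χ 0, fun j x => by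
      rw [hexp, hw0, Pi.zero_apply, mul_zero, add_zero]⟩
  have hpos : ∀ {v : Fin 2 × Fin 2 → ℂ}, v ≠ 0 → 0 < (traceFst (proj v)).trace.re := by
    intro v hv
    rw [trace_traceFst]
    exact lt_of_le_of_ne (trace_proj_re_nonneg v) fun h => hv (eq_zero_of_trace_proj h.symm)
  have hgain := avgCapacity_sub_capacity_of_orthogonal hχ hV horth
  have hle := avgCapacity_le_controlledCapacity hV χ
  obtain ⟨hd0, hd1, htr⟩ := orthogonal_of_trLog_add_le (posSemidef_traceFst_proj (branch V χ 0))
    (posSemidef_traceFst_proj (branch V χ 1)) (hpos hv0) (hpos hw0) (by linarith)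
  have hsup := trLog_superadditive (posSemidef_traceFst_proj (branch V χ 0))
    (posSemidef_traceFst_proj (branch V χ 1))
  have hT : ∀ {v : Fin 2 × Fin 2 → ℂ}, (traceFst (proj v)).det.re = 0 →
      trLog (traceFst (proj v)) = xlog (proj v).trace.re := by
    intro v hv
    rw [trLog_eq_of_trace_det (posSemidef_traceFst_proj v) (u := (proj v).trace.re) (v := 0)
      (by rw [trace_traceFst, add_zero]) (by rw [hv, mul_zero]), xlog_zero, add_zero]
  -- With zero gain in the eigenbasis, this says that ρ_B and ρ_AB have equal entropy, so the last
  -- two terms of the gain cancel in every basis.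
  have hρ : trLog (traceFst (proj χ)) = trLog (traceFst (proj (branch V χ 0))) +
      trLog (traceFst (proj (branch V χ 1))) := by
    rw [hT hd0, hT hd1, traceFst_proj_eq_add hV, trLog_proj_add_proj horth]
  have hW : hadamard * V ∈ unitaryGroup (Fin 2) ℂ := mul_mem hadamard_mem_unitaryGroup hV
  have hgain' := avgCapacity_sub_capacity hW hχ
  have hle' := avgCapacity_le_controlledCapacity hW χ
  rw [← traceFst_add, ← traceFst_proj_eq_add hW, traceFst_proj_eq_add hV, traceFst_add] at hgain'
  rw [← traceFst_proj_eq_add hV] at hgain'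
  have hx0 := trLog_le_xlog_trace (posSemidef_traceFst_proj (branch (hadamard * V) χ 0))
  have hx1 := trLog_le_xlog_trace (posSemidef_traceFst_proj (branch (hadamard * V) χ 1))
  rw [trace_traceFst] at hx0 hx1
  -- The gain in the rotated basis is now a sum of two nonnegative terms, the entanglement of the
  -- branches, and is at most zero; hence the branch (v + w)/√2 is a product.
  have hdet := coeff_det_eq_zero (det_re_eq_zero_of_xlog_trace_le
    (posSemidef_traceFst_proj (branch (hadamard * V) χ 0)) (by rw [trace_traceFst]; linarith))
  have hc : ((Real.sqrt 2)⁻¹ : ℂ) ≠ 0 := by simp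
  have hb : ∀ x, branch (hadamard * V) χ 0 x =
      ((Real.sqrt 2)⁻¹ : ℂ) * (branch V χ 0 + branch V χ 1) x := by
    intro x
    rw [branch_mul]
    simp [hadamard]
    ring
  have hsum : (branch V χ 0 + branch V χ 1) (0, 0) * (branch V χ 0 + branch V χ 1) (1, 1) =
      (branch V χ 0 + branch V χ 1) (0, 1) * (branch V χ 0 + branch V χ 1) (1, 0) := by
    simp only [hb] at hdet
    refine mul_left_cancel₀ (mul_ne_zero hc hc) ?_
    linear_combination hdet
  obtain ⟨a, b, d, hab, had⟩ := exists_common_factor hv0 hw0 (coeff_det_eq_zero hd0)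
    (coeff_det_eq_zero hd1) hsum htr
  refine Or.inr ⟨a, fun y => star (V 0 y.1) * b y.2 + star (V 1 y.1) * d y.2, fun j x => ?_⟩
  rw [hexp, hab, had]
  ring

/-! ### Passing to permutations of the three qubits -/

/-- The basis labels of the three qubits in the order (Charlie, Alice, Bob). -/
def arrangeEquiv (σ : Equiv.Perm (Fin 3)) : (Fin 3 → Fin 2) ≃ Fin 2 × (Fin 2 × Fin 2) where
  toFun x := (x (σ 0), x (σ 1), x (σ 2))
  invFun y q := ![y.1, y.2.1, y.2.2] (σ.symm q)
  left_inv x := by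
    funext q
    obtain ⟨k, rfl⟩ := σ.surjective q
    fin_cases k <;> simp
  right_inv y := by simp

theorem trace_proj_arrange (σ : Equiv.Perm (Fin 3)) {ψ : EuclideanSpace ℂ (Fin 3 → Fin 2)}
    (hψ : ‖ψ‖ = 1) : (proj fun y => ψ ((arrangeEquiv σ).symm y)).trace.re = 1 := by
  rw [trace_proj_re, Equiv.sum_comp (arrangeEquiv σ).symm fun x => ‖ψ x‖ ^ 2,
    ← EuclideanSpace.norm_sq_eq, hψ, one_pow]

theorem controlPower_nonneg (σ : Equiv.Perm (Fin 3)) {ψ : EuclideanSpace ℂ (Fin 3 → Fin 2)}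
    (hψ : ‖ψ‖ = 1) : 0 ≤ controlPower σ (pureState ψ) :=
  -- `arrange σ (pureState ψ)` is by definition the `proj` of the relabelled vector.
  sub_nonneg.2 (capacity_le_controlledCapacity (trace_proj_arrange σ hψ))

theorem isBiseparable_of_controlPower_le {σ : Equiv.Perm (Fin 3)}
    {ψ : EuclideanSpace ℂ (Fin 3 → Fin 2)} (hψ : ‖ψ‖ = 1)
    (h : controlPower σ (pureState ψ) ≤ 0) : IsBiseparable ψ := by
  have e : ∀ x, ψ x = ψ ((arrangeEquiv σ).symm (x (σ 0), x (σ 1), x (σ 2))) := fun x =>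
    congrArg ψ ((arrangeEquiv σ).symm_apply_apply x).symm
  rcases product_of_controlledCapacity_le (trace_proj_arrange σ hψ) (sub_nonpos.1 h) with
    ⟨a, b, hab⟩ | ⟨a, b, hab⟩
  · exact ⟨σ, a, b, fun x => (e x).trans (hab _ _)⟩
  -- Here Alice's qubit splits off, so it takes the first place in the permutation.
  · refine ⟨σ * Equiv.swap 0 1, a, b, fun x => (e x).trans ((hab _ _).trans ?_)⟩
    have h2 : Equiv.swap (0 : Fin 3) 1 2 = 2 := by decide
    simp [h2]

theorem controlPower_le_of_product {σ : Equiv.Perm (Fin 3)}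
    {ψ : EuclideanSpace ℂ (Fin 3 → Fin 2)} (hψ : ‖ψ‖ = 1) {a : Fin 2 → ℂ}
    {b : Fin 2 × Fin 2 → ℂ} (h : ∀ x : Fin 3 → Fin 2, ψ x = a (x (σ 0)) * b (x (σ 1), x (σ 2))) :
    controlPower σ (pureState ψ) ≤ 0 := by
  refine sub_nonpos.2 (controlledCapacity_le_of_product (trace_proj_arrange σ hψ) (a := a) (b := b)
    fun y => ?_)
  exact (h _).trans (congrArg (fun z : Fin 2 × (Fin 2 × Fin 2) => a z.1 * b z.2)
    ((arrangeEquiv σ).apply_symm_apply y))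

theorem IsFullySeparable.isBiseparable {ψ : EuclideanSpace ℂ (Fin 3 → Fin 2)}
    (h : IsFullySeparable ψ) : IsBiseparable ψ := by
  obtain ⟨a, b, c, h⟩ := h
  exact ⟨1, a, fun y => b y.1 * c y.2, fun x => by rw [h, mul_assoc]; rfl⟩

end DenseCoding

theorem proposition3 (ψ : EuclideanSpace ℂ (Fin 3 → Fin 2)) (hψ : ‖ψ‖ = 1) :
    DenseCoding.minControlPower (DenseCoding.pureState ψ) = 0 ↔
      DenseCoding.IsBiseparable ψ ∨ DenseCoding.IsFullySeparable ψ := by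
  constructor
  · intro h
    obtain ⟨σ, -, hσ⟩ := Finset.exists_mem_eq_inf' Finset.univ_nonempty
      fun σ : Equiv.Perm (Fin 3) => DenseCoding.controlPower σ (DenseCoding.pureState ψ)
    exact Or.inl (DenseCoding.isBiseparable_of_controlPower_le hψ (hσ.symm.trans h).le)
  · intro h
    obtain ⟨σ, a, b, hab⟩ := h.elim id DenseCoding.IsFullySeparable.isBiseparable
    refine le_antisymm ?_ (Finset.le_inf' _ _ fun τ _ => DenseCoding.controlPower_nonneg τ hψ)
    exact (Finset.inf'_le _ (Finset.mem_univ σ)).trans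
      (DenseCoding.controlPower_le_of_product hψ hab)
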